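/- Let $\mathfrak I_n$ be the set of involutions ($\pi=\pi^{-1}$) in the symmetric group $\mathfrak S_n$, $n\ge 0$. A permutation is even if its number of inversions is even; it contains a pattern $\tau\in\mathfrak S_k$ if it has a subsequence of length $k$ order-isomorphic to $\tau$, and avoids $\tau$ otherwise. For $k\ge1$ let $$I_{12\dots k}(x)=\sum_{n\ge0}\bigl|\{\pi\in\mathfrak I_n:\pi\text{ avoids }132\text{ and }12\dots k\}\bigr|\,x^n,$$ $$I^e_{12\dots k}(x)=\sum_{n\ge0}\bigl|\{\pi\in\mathfrak I_n:\pi\text{ is even and avoids }132\text{ and }12\dots k\}\bigr|\,x^n .$$ Let $U_r$ be the Chebyshev polynomials of the second kind, $U_0(t)=1$, $U_1(t)=2t$, $U_r(t)=2tU_{r-1}(t)-U_{r-2}(t)$ for $r\ge 2$, with the convention $U_{-1}=0$, and for $k\ge 0$ let $$R_k(x)=\frac{U_{k-1}\left(\frac1{2\sqrt x}\right)}{\sqrt x\,U_k\left(\frac1{2\sqrt x}\right)},\qquad R^e_k(x)=\tfrac12\bigl(R_k(x)+R_k(-x)\bigr);$$ these are rational functions of $x$, and $R_0=0$. **Theorem.**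 For all $k\ge1$, $$I^e_{12\dots k}(x)=\sum_{j=0}^{k-1}\left(x^j\Bigl(1+x^2R^e_{k-1-j}(x^2)\,I_{12\dots(k-j)}(x)\Bigr)\prod_{i=k-j}^{k}R_i(-x^2)\right),$$ where $$I_{12\dots k}(x)=\frac{1}{x\,U_k\left(\frac1{2x}\right)}\sum_{j=0}^{k-1}U_j\left(\frac1{2x}\right).$$ Both are identities of formal power series in $x$. -/

import Mathlib

/-- The permutation `π` contains the pattern `τ`: there are positions `i₁ < ⋯ < i_k` such that
`(π i₁, …, π i_k)` is order-isomorphic to `τ`. -/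
def PermContains {k n : ℕ} (τ : Equiv.Perm (Fin k)) (π : Equiv.Perm (Fin n)) : Prop :=
  ∃ f : Fin k → Fin n, StrictMono f ∧ ∀ a b : Fin k, π (f a) < π (f b) ↔ τ a < τ b

/-- The permutation `π` avoids the pattern `τ`. -/
def PermAvoids {k n : ℕ} (τ : Equiv.Perm (Fin k)) (π : Equiv.Perm (Fin n)) : Prop :=
  ¬ PermContains τ π

/-- The pattern `132` (in 0-based one-line notation `0 2 1`). -/
def pattern132 : Equiv.Perm (Fin 3) := Equiv.swap 1 2

/-- The pattern `12…k`. -/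
def increasingPattern (k : ℕ) : Equiv.Perm (Fin k) := 1

/-- The number of inversions of `π`. -/
def inversionCount {n : ℕ} (π : Equiv.Perm (Fin n)) : ℕ :=
  (Finset.univ.filter fun p : Fin n × Fin n => p.1 < p.2 ∧ π p.2 < π p.1).card

/-- The involutions of `n` letters avoiding both `132` and `τ`. The identity counts as an
involution, and so does the empty permutation. -/
def avoidingInvolutions {k : ℕ} (τ : Equiv.Perm (Fin k)) (n : ℕ) : Set (Equiv.Perm (Fin n)) :=
  {π | π⁻¹ = π ∧ PermAvoids pattern132 π ∧ PermAvoids τ π}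

/-- The even involutions (even number of inversions) of `n` letters avoiding both `132`
and `τ`. -/
def avoidingEvenInvolutions {k : ℕ} (τ : Equiv.Perm (Fin k)) (n : ℕ) :
    Set (Equiv.Perm (Fin n)) :=
  {π | π ∈ avoidingInvolutions τ n ∧ Even (inversionCount π)}

/-- The generating function `I_τ(x)`, as a formal power series. -/
noncomputable def involutionGF {k : ℕ} (τ : Equiv.Perm (Fin k)) : PowerSeries ℂ :=
  PowerSeries.mk fun n => ((avoidingInvolutions τ n).ncard : ℂ)

/-- The generating function `I^e_τ(x)`, as a formal power series. -/
noncomputable def evenInvolutionGF {k : ℕ} (τ : Equiv.Perm (Fin k)) : PowerSeries ℂ :=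
  PowerSeries.mk fun n => ((avoidingEvenInvolutions τ n).ncard : ℂ)

/-- The value `U_k(t)` of the Chebyshev polynomial of the second kind
(with `U_{-1} = 0`). -/
noncomputable def chebU {K : Type*} [Field K] (k : ℤ) (t : K) : K :=
  (Polynomial.Chebyshev.U K k).eval t

open Classical in
/-- `R_k(y) = U_{k-1}(1/(2√y)) / (√y U_k(1/(2√y)))`, for an element `y` of a field that has a
square root `√y` there; by `chebR_mul_self` any of its square roots gives the same value.
For `k = 0` this is `0`, since `U_{-1} = 0`. -/
noncomputable def chebR {K : Type*} [Field K] (k : ℕ) (y : K) : K :=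
  if h : IsSquare y then
    chebU ((k : ℤ) - 1) (1 / (2 * h.choose)) / (h.choose * chebU k (1 / (2 * h.choose)))
  else 0

theorem chebR_mul_self {K : Type*} [Field K] (k : ℕ) (s : K) :
    chebR k (s * s) = chebU ((k : ℤ) - 1) (1 / (2 * s)) / (s * chebU k (1 / (2 * s))) := by
  have h : IsSquare (s * s) := ⟨s, rfl⟩
  have hc : s * s = h.choose * h.choose := h.choose_spec
  rw [chebR, dif_pos h]
  generalize h.choose = r at hc ⊢
  rcases mul_self_eq_mul_self_iff.mp hc with rfl | rfl
  · rfl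
  · have e : (1 : K) / (2 * -r) = -(1 / (2 * r)) := by rw [mul_neg, div_neg]
    rw [e]
    cases k with
    | zero => simp [chebU]
    | succ m =>
      have h1 : ((m + 1 : ℕ) : ℤ) - 1 = (m : ℤ) := by push_cast; ring
      rw [h1]
      simp only [chebU, Polynomial.Chebyshev.U_eval_neg]
      rcases Int.even_or_odd (m : ℤ) with hm | hm
      · have hm' : Odd ((m + 1 : ℕ) : ℤ) := by push_cast; exact hm.add_one
        rw [Int.negOnePow_even _ hm, Int.negOnePow_odd _ hm']
        simp
      · have hm' : Even ((m + 1 : ℕ) : ℤ) := by push_cast; exact hm.add_one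
        rw [Int.negOnePow_odd _ hm, Int.negOnePow_even _ hm']
        simp [neg_div, div_neg]

/-- `R^e_k(y) = (R_k(y) + R_k(-y)) / 2`. -/
noncomputable def chebRe {K : Type*} [Field K] (k : ℕ) (y : K) : K :=
  (chebR k y + chebR k (-y)) / 2

/-- The formal variable `x`, in the field of formal Laurent series over `ℂ`; there
`√(x²) = ± x` and `√(-x²) = ± i x`. -/
noncomputable def formalX : LaurentSeries ℂ := ((PowerSeries.X : PowerSeries ℂ) : LaurentSeries ℂ)

/-!
Write `σ ⊕ 1` for `σ` followed by a new maximum and `A ⊖ B` for the skew sum, in which the letters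
of `A` precede and exceed those of `B`. A nonempty `132`-avoider has the unique form
`(α ⊕ 1) ⊖ B`, because no letter after the maximum exceeds a letter before it. An involution
avoiding `132` is either `σ ⊕ 1` or `A ⊖ B ⊖ A⁻¹` with `A = α ⊕ 1` and `B` an involution
(`filter_involutiveAvoiders_last`, `filter_involutiveAvoiders_eq_image`): an involution exchanges
positions and values, so the block of the largest values forces the block of the last positions.
Increasing subsequences of a skew sum stay in one block, and those of `σ ⊕ 1` may be prolonged
by the maximum. Hence, with `C_k` the generating function of all avoiders of `132` and `12…k`,

* `C_{k+1}(x) = 1 + x C_k(x) C_{k+1}(x)` and `C_0 = 0`, which is the recurrence satisfied by the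
  Chebyshev quotients, so `C_k = R_k` (`chebU_ne_zero_and_chebR_eq`);
* for `ε = ± 1` the involutions counted with weight `ε ^ inv` have a generating function `W_k` with
  `W_{k+1} = 1 + x W_k + ε x² R_k(ε x²) W_{k+1}` (`weightedGF_succ`). The sign enters through the
  inversion count: those of `A ⊖ B ⊖ A⁻¹` number `|A|` plus those of `B`, modulo `2`.

For `ε = 1` this gives `I_{k+1} = (1 + x I_k) R_{k+1}(x²)`, and multiplying by
`x U_{k+1}(1 / 2x)` turns it into a telescoping sum. The even involutions are counted by half the
sum of the two weighted series; eliminating the signed one leaves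
`I^e_{k+1} = (1 + x² R^e_k(x²) I_{k+1} + x I^e_k) R_{k+1}(-x²)`, whose iteration is the formula.
-/

open Finset

/-! ### Patterns and inversions -/

theorem permAvoids_pattern132_iff {n : ℕ} (π : Equiv.Perm (Fin n)) :
    PermAvoids pattern132 π ↔ ∀ a b c : Fin n, a < b → b < c → ¬ (π a < π c ∧ π c < π b) := by
  have h0 : pattern132 0 = 0 := by decide
  have h1 : pattern132 1 = 2 := by decide
  have h2 : pattern132 2 = 1 := by decide
  unfold PermAvoids
  rw [not_iff_comm]
  push Not
  constructor
  · rintro ⟨a, b, c, hab, hbc, hac, hcb⟩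
    refine ⟨![a, b, c], ?_, ?_⟩
    · rw [Fin.strictMono_iff_lt_succ]
      intro i
      fin_cases i <;> simpa
    · intro i j
      fin_cases i <;> fin_cases j <;> simp [h0, h1, h2] <;> order
  · rintro ⟨f, hf, h⟩
    refine ⟨f 0, f 1, f 2, hf (by decide), hf (by decide), (h 0 2).2 ?_, (h 2 1).2 ?_⟩
    · rw [h0, h2]; decide
    · rw [h1, h2]; decide

theorem permContains_increasingPattern_iff {k n : ℕ} (π : Equiv.Perm (Fin n)) :
    PermContains (increasingPattern k) π ↔
      ∃ f : Fin k → Fin n, StrictMono f ∧ StrictMono fun i => π (f i) := by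
  constructor
  · rintro ⟨f, hf, h⟩
    exact ⟨f, hf, fun a b hab => (h a b).2 hab⟩
  · rintro ⟨f, hf, h⟩
    exact ⟨f, hf, fun a b => h.lt_iff_lt⟩

theorem permContains_inv {k n : ℕ} {τ : Equiv.Perm (Fin k)} {π : Equiv.Perm (Fin n)}
    (h : PermContains τ π) : PermContains τ⁻¹ π⁻¹ := by
  obtain ⟨f, hf, h⟩ := h
  refine ⟨fun i => π (f (τ⁻¹ i)), fun a b hab => ?_, fun a b => ?_⟩
  · rw [h]; simpa using hab
  · simpa using hf.lt_iff_lt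

theorem permAvoids_inv {k n : ℕ} {τ : Equiv.Perm (Fin k)} {π : Equiv.Perm (Fin n)}
    (hτ : τ⁻¹ = τ) : PermAvoids τ π⁻¹ ↔ PermAvoids τ π := by
  refine not_congr ⟨fun h => ?_, fun h => ?_⟩
  · simpa [hτ] using permContains_inv h
  · simpa [hτ] using permContains_inv h

/-- The indicator form of the inversion count, convenient for reindexing. -/
theorem inversionCount_eq_sum {n : ℕ} (π : Equiv.Perm (Fin n)) :
    inversionCount π = ∑ p : Fin n, ∑ q : Fin n, if p < q ∧ π q < π p then 1 else 0 := by
  rw [inversionCount, card_filter, ← univ_product_univ, sum_product]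

theorem inversionCount_inv {n : ℕ} (π : Equiv.Perm (Fin n)) :
    inversionCount π⁻¹ = inversionCount π := by
  rw [inversionCount_eq_sum, inversionCount_eq_sum, ← Equiv.sum_comp π, sum_comm]
  rw [← Equiv.sum_comp π]
  simp [and_comm]

/-! ### Appending a new maximum -/

/-- The direct sum `σ ⊕ 1`: the permutation `σ` followed by a new largest letter. -/
def appendMax {n : ℕ} (σ : Equiv.Perm (Fin n)) : Equiv.Perm (Fin (n + 1)) :=
  (finSuccEquivLast.trans (Equiv.optionCongr σ)).trans finSuccEquivLast.symm

@[simp] theorem appendMax_castSucc {n : ℕ} (σ : Equiv.Perm (Fin n)) (i : Fin n) :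
    appendMax σ i.castSucc = (σ i).castSucc := by
  simp [appendMax]

@[simp] theorem appendMax_last {n : ℕ} (σ : Equiv.Perm (Fin n)) :
    appendMax σ (Fin.last n) = Fin.last n := by
  simp [appendMax]

theorem appendMax_injective {n : ℕ} : Function.Injective (appendMax (n := n)) := by
  intro σ τ h
  ext i
  have := congrArg (fun π => (π i.castSucc).val) h
  simpa using this

theorem appendMax_inv {n : ℕ} (σ : Equiv.Perm (Fin n)) : (appendMax σ)⁻¹ = appendMax σ⁻¹ := by
  rw [inv_eq_iff_mul_eq_one]
  ext i
  induction i using Fin.lastCases <;> simp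

theorem exists_appendMax_eq {n : ℕ} {π : Equiv.Perm (Fin (n + 1))}
    (h : π (Fin.last n) = Fin.last n) : ∃ σ, appendMax σ = π := by
  have key : ∀ (ρ : Equiv.Perm (Fin (n + 1))), ρ (Fin.last n) = Fin.last n →
      ∀ i : Fin n, ρ i.castSucc ≠ Fin.last n := by
    intro ρ hρ i hi
    exact (Fin.castSucc_lt_last i).ne (ρ.injective (hi.trans hρ.symm))
  have h' : π⁻¹ (Fin.last n) = Fin.last n := by rw [Equiv.Perm.inv_eq_iff_eq, h]
  refine ⟨⟨fun i => (π i.castSucc).castPred (key π h i),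
    fun i => (π⁻¹ i.castSucc).castPred (key _ h' i), fun i => ?_, fun i => ?_⟩, ?_⟩
  · simp
  · simp
  · ext i
    induction i using Fin.lastCases with
    | last => simp [h]
    | cast i => simp

theorem permAvoids_pattern132_appendMax {n : ℕ} (σ : Equiv.Perm (Fin n)) :
    PermAvoids pattern132 (appendMax σ) ↔ PermAvoids pattern132 σ := by
  rw [permAvoids_pattern132_iff, permAvoids_pattern132_iff]
  constructor
  · intro h a b c hab hbc
    simpa using h a.castSucc b.castSucc c.castSucc (by simpa) (by simpa)
  · intro h a b c hab hbc
    induction c using Fin.lastCases with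
    | last => simp [(Fin.le_last _).not_gt]
    | cast c =>
      have hb : b ≠ Fin.last n := (hbc.trans (Fin.castSucc_lt_last c)).ne
      have ha : a ≠ Fin.last n := (hab.trans_le (Fin.le_last b)).ne
      obtain ⟨b, rfl⟩ := Fin.exists_castSucc_eq.2 hb
      obtain ⟨a, rfl⟩ := Fin.exists_castSucc_eq.2 ha
      simpa using h a b c (by simpa using hab) (by simpa using hbc)

theorem permContains_increasingPattern_appendMax {k n : ℕ} (σ : Equiv.Perm (Fin n)) :
    PermContains (increasingPattern (k + 1)) (appendMax σ) ↔
      PermContains (increasingPattern k) σ := by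
  rw [permContains_increasingPattern_iff, permContains_increasingPattern_iff]
  constructor
  · rintro ⟨f, hf, h⟩
    have hne : ∀ i : Fin k, f i.castSucc ≠ Fin.last n := fun i =>
      ((hf (Fin.castSucc_lt_last i)).trans_le (Fin.le_last _)).ne
    choose g hg using fun i => Fin.exists_castSucc_eq.2 (hne i)
    refine ⟨g, fun a b hab => ?_, fun a b hab => ?_⟩
    · rw [← Fin.castSucc_lt_castSucc_iff, hg, hg]
      exact hf (by simpa)
    · have := h (Fin.castSucc_lt_castSucc_iff.2 hab)
      simpa [← hg] using this
  · rintro ⟨f, hf, h⟩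
    refine ⟨Fin.snoc (fun i => (f i).castSucc) (Fin.last n), fun a b hab => ?_,
      fun a b hab => ?_⟩ <;>
    · have ha : a ≠ Fin.last k := (hab.trans_le (Fin.le_last b)).ne
      obtain ⟨a, rfl⟩ := Fin.exists_castSucc_eq.2 ha
      induction b using Fin.lastCases with
      | last => simp [Fin.castSucc_lt_last]
      | cast b =>
        have hab : a < b := by simpa using hab
        first
        | simpa using hf hab
        | simpa using h hab

theorem inversionCount_appendMax {n : ℕ} (σ : Equiv.Perm (Fin n)) :
    inversionCount (appendMax σ) = inversionCount σ := by
  rw [inversionCount_eq_sum, inversionCount_eq_sum, Fin.sum_univ_castSucc]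
  simp only [Fin.sum_univ_castSucc]
  simp [(Fin.le_last _).not_gt]

/-! ### Skew sums -/

/-- The splitting of `n = m + l` positions into a first block of `m` and a second block of `l`. -/
def blockEquiv {m l n : ℕ} (h : m + l = n) : Fin m ⊕ Fin l ≃ Fin n :=
  finSumFinEquiv.trans (finCongr h)

@[simp] theorem val_blockEquiv_inl {m l n : ℕ} (h : m + l = n) (i : Fin m) :
    (blockEquiv h (Sum.inl i)).val = i := by
  simp [blockEquiv]

@[simp] theorem val_blockEquiv_inr {m l n : ℕ} (h : m + l = n) (i : Fin l) :
    (blockEquiv h (Sum.inr i)).val = m + i := by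
  simp [blockEquiv]

theorem blockEquiv_lt_iff {m l n : ℕ} (h : m + l = n) (x y : Fin m ⊕ Fin l) :
    blockEquiv h x < blockEquiv h y ↔ toLex x < toLex y := by
  rw [Fin.lt_def]
  rcases x with i | i <;> rcases y with j | j <;> simp <;> omega

/-- The skew sum `A ⊖ B`: the letters of `A` come first and exceed all the letters of `B`.
The length is allowed to be any `n` with a proof of `m + l = n`, which avoids casts. -/
def skewSum {m l n : ℕ} (h : m + l = n) (A : Equiv.Perm (Fin m)) (B : Equiv.Perm (Fin l)) :
    Equiv.Perm (Fin n) :=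
  (((blockEquiv h).symm.trans (Equiv.sumCongr A B)).trans (Equiv.sumComm _ _)).trans
    (blockEquiv ((add_comm l m).trans h))

section SkewSum

variable {m l n : ℕ} (h : m + l = n) (A : Equiv.Perm (Fin m)) (B : Equiv.Perm (Fin l))

theorem skewSum_blockEquiv (x : Fin m ⊕ Fin l) :
    skewSum h A B (blockEquiv h x) =
      blockEquiv ((add_comm l m).trans h) (Sum.map A B x).swap := by
  simp [skewSum]

@[simp] theorem skewSum_inl (i : Fin m) :
    skewSum h A B (blockEquiv h (Sum.inl i)) =
      blockEquiv ((add_comm l m).trans h) (Sum.inr (A i)) := by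
  simp [skewSum]

@[simp] theorem skewSum_inr (i : Fin l) :
    skewSum h A B (blockEquiv h (Sum.inr i)) =
      blockEquiv ((add_comm l m).trans h) (Sum.inl (B i)) := by
  simp [skewSum]

theorem skewSum_injective {A A' : Equiv.Perm (Fin m)} {B B' : Equiv.Perm (Fin l)}
    (heq : skewSum h A B = skewSum h A' B') : A = A' ∧ B = B' := by
  constructor
  · ext i
    have := congrArg (fun π => π (blockEquiv h (Sum.inl i))) heq
    simpa [Fin.ext_iff] using this
  · ext i
    have := congrArg (fun π => π (blockEquiv h (Sum.inr i))) heq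
    simpa [Fin.ext_iff] using this

/-- A permutation sending the first `m` positions to the largest `m` values is a skew sum. -/
theorem exists_skewSum_eq {π : Equiv.Perm (Fin n)}
    (hπ : ∀ i : Fin n, i.val < m → l ≤ (π i).val) : ∃ A B, skewSum h A B = π := by
  have hl := (add_comm l m).trans h
  let σ : Equiv.Perm (Fin m ⊕ Fin l) :=
    (((blockEquiv h).trans π).trans (blockEquiv hl).symm).trans (Equiv.sumComm _ _)
  have hσ : σ ∈ (Equiv.Perm.sumCongrHom (Fin m) (Fin l)).range := by
    apply Equiv.Perm.mem_sumCongrHom_range_of_perm_mapsTo_inl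
    rintro _ ⟨i, rfl⟩
    have h1 := hπ (blockEquiv h (Sum.inl i)) (by simp)
    obtain ⟨y, hy⟩ := (blockEquiv hl).surjective (π (blockEquiv h (Sum.inl i)))
    rw [← hy] at h1
    rcases y with y | y
    · simp at h1; omega
    · exact ⟨y, by simp [σ, ← hy]⟩
  obtain ⟨⟨A, B⟩, hAB⟩ := hσ
  refine ⟨A, B, Equiv.ext fun x => ?_⟩
  obtain ⟨x, rfl⟩ := (blockEquiv h).surjective x
  have := congrArg (fun π => blockEquiv hl (π x).swap) hAB
  rw [skewSum_blockEquiv]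
  simpa [σ] using this

/-- Three-block skew sums invert blockwise with the outer blocks exchanged. -/
theorem skewSum_skewSum_inv {m l r n : ℕ} (h : m + r = n) (h' : l + m = r)
    (A A' : Equiv.Perm (Fin m)) (B : Equiv.Perm (Fin l)) :
    (skewSum h A (skewSum h' B A'))⁻¹ = skewSum h A'⁻¹ (skewSum h' B⁻¹ A⁻¹) := by
  have hl := (add_comm m l).trans h'
  have hr := (add_comm r m).trans h
  have e1 : ∀ i : Fin m, blockEquiv hr (Sum.inr i) =
      blockEquiv h (Sum.inr (blockEquiv h' (Sum.inr i))) := fun i => by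
    ext; simp; omega
  have e2 : ∀ i : Fin l, blockEquiv hr (Sum.inl (blockEquiv hl (Sum.inr i))) =
      blockEquiv h (Sum.inr (blockEquiv h' (Sum.inl i))) := fun i => by
    ext; simp
  have e3 : ∀ i : Fin m, blockEquiv hr (Sum.inl (blockEquiv hl (Sum.inl i))) =
      blockEquiv h (Sum.inl i) := fun i => by
    ext; simp
  rw [inv_eq_iff_mul_eq_one]
  refine Equiv.ext fun x => ?_
  obtain ⟨x, rfl⟩ := (blockEquiv h).surjective x
  rw [Equiv.Perm.mul_apply, Equiv.Perm.one_apply]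
  rcases x with i | x
  · rw [skewSum_inl, e1, skewSum_inr, skewSum_inr, e3]; simp
  · obtain ⟨x, rfl⟩ := (blockEquiv h').surjective x
    rcases x with i | i
    · rw [skewSum_inr, skewSum_inl, e2, skewSum_inr, skewSum_inl, e2]; simp
    · rw [skewSum_inr, skewSum_inr, e3, skewSum_inl, e1]; simp

theorem permAvoids_pattern132_skewSum :
    PermAvoids pattern132 (skewSum h A B) ↔
      PermAvoids pattern132 A ∧ PermAvoids pattern132 B := by
  simp only [permAvoids_pattern132_iff]
  constructor
  · intro H
    refine ⟨fun a b c hab hbc => ?_, fun a b c hab hbc => ?_⟩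
    · simpa [blockEquiv_lt_iff] using H (blockEquiv h (Sum.inl a)) (blockEquiv h (Sum.inl b))
        (blockEquiv h (Sum.inl c)) (by simpa [blockEquiv_lt_iff]) (by simpa [blockEquiv_lt_iff])
    · simpa [blockEquiv_lt_iff] using H (blockEquiv h (Sum.inr a)) (blockEquiv h (Sum.inr b))
        (blockEquiv h (Sum.inr c)) (by simpa [blockEquiv_lt_iff]) (by simpa [blockEquiv_lt_iff])
  · rintro ⟨hA, hB⟩ a b c
    obtain ⟨a, rfl⟩ := (blockEquiv h).surjective a
    obtain ⟨b, rfl⟩ := (blockEquiv h).surjective b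
    obtain ⟨c, rfl⟩ := (blockEquiv h).surjective c
    rcases a with a | a <;> rcases b with b | b <;> rcases c with c | c <;>
      simp [blockEquiv_lt_iff] <;>
      first | simpa using hA a b c | simpa using hB a b c

theorem permContains_increasingPattern_skewSum {k : ℕ} :
    PermContains (increasingPattern (k + 1)) (skewSum h A B) ↔
      PermContains (increasingPattern (k + 1)) A ∨
        PermContains (increasingPattern (k + 1)) B := by
  simp only [permContains_increasingPattern_iff]
  constructor
  · rintro ⟨f, hf, H⟩
    choose g hg using fun i => (blockEquiv h).surjective (f i)
    -- The first letter of an increasing subsequence decides in which block the rest lies.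
    rcases h0 : g 0 with a | b
    · left
      have hx : ∀ i, ∃ a, g i = Sum.inl a := fun i => by
        rcases hi : g i with a' | b'
        · exact ⟨a', rfl⟩
        · have := H.monotone (Fin.zero_le i)
          simp only [← hg, h0, hi] at this
          rw [← not_lt, skewSum_inl, skewSum_inr, blockEquiv_lt_iff] at this
          simp at this
      choose u hu using hx
      refine ⟨u, fun a b hab => ?_, fun a b hab => ?_⟩
      · simpa [← hg, hu, blockEquiv_lt_iff] using hf hab
      · simpa [← hg, hu, blockEquiv_lt_iff] using H hab
    · right
      have hx : ∀ i, ∃ a, g i = Sum.inr a := fun i => by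
        rcases hi : g i with a' | b'
        · have := hf.monotone (Fin.zero_le i)
          simp only [← hg, h0, hi] at this
          rw [← not_lt, blockEquiv_lt_iff] at this
          simp at this
        · exact ⟨b', rfl⟩
      choose u hu using hx
      refine ⟨u, fun a b hab => ?_, fun a b hab => ?_⟩
      · simpa [← hg, hu, blockEquiv_lt_iff] using hf hab
      · simpa [← hg, hu, blockEquiv_lt_iff] using H hab
  · rintro (⟨f, hf, H⟩ | ⟨f, hf, H⟩)
    · refine ⟨fun i => blockEquiv h (Sum.inl (f i)), fun a b hab => ?_, fun a b hab => ?_⟩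
      · simpa [blockEquiv_lt_iff] using hf hab
      · simpa [blockEquiv_lt_iff] using H hab
    · refine ⟨fun i => blockEquiv h (Sum.inr (f i)), fun a b hab => ?_, fun a b hab => ?_⟩
      · simpa [blockEquiv_lt_iff] using hf hab
      · simpa [blockEquiv_lt_iff] using H hab

theorem inversionCount_skewSum :
    inversionCount (skewSum h A B) = inversionCount A + inversionCount B + m * l := by
  simp only [inversionCount_eq_sum]
  rw [← Equiv.sum_comp (blockEquiv h), Fintype.sum_sum_type]
  simp only [← Equiv.sum_comp (blockEquiv h) (fun q => ite (_ < q ∧ _) 1 0),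
    Fintype.sum_sum_type, blockEquiv_lt_iff, skewSum_inl, skewSum_inr]
  simp [sum_add_distrib]
  ring

end SkewSum

/-- In a `132`-avoider every letter before the maximum exceeds every letter after it, so the
letters up to the maximum form the first block of a skew sum. -/
theorem exists_skewSum_eq_of_permAvoids {m l n : ℕ} (h : m + 1 + l = n + 1)
    {π : Equiv.Perm (Fin (n + 1))} (hπ : PermAvoids pattern132 π) {j : Fin (n + 1)}
    (hj : j.val = m) (hmax : π j = Fin.last n) :
    ∃ α B, skewSum h (appendMax α) B = π := by
  rw [permAvoids_pattern132_iff] at hπ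
  have hlt : ∀ i p, i ≤ j → j < p → π p < π i := by
    intro i p hi hp
    have hp' : π p < π j :=
      lt_of_le_of_ne (hmax ▸ Fin.le_last _) fun e => hp.ne' (π.injective e)
    rcases hi.eq_or_lt with rfl | hi
    · exact hp'
    · by_contra hc
      exact hπ i j p hi hp
        ⟨lt_of_le_of_ne (not_lt.1 hc) fun e => (hi.trans hp).ne (π.injective e), hp'⟩
  obtain ⟨A, B, rfl⟩ := exists_skewSum_eq h (π := π) fun i hi => by
    have hsub : (Ioi j).map π.toEmbedding ⊆ Iio (π i) := by
      intro v hv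
      obtain ⟨p, hp, rfl⟩ := mem_map.1 hv
      exact mem_Iio.2 (hlt i p (by rw [Fin.le_def]; omega) (mem_Ioi.1 hp))
    have := card_le_card hsub
    rw [card_map, Fin.card_Ioi, Fin.card_Iio] at this
    omega
  have hA : A (Fin.last m) = Fin.last m := by
    have e : j = blockEquiv h (Sum.inl (Fin.last m)) := by ext; simp [hj]
    rw [e, skewSum_inl, Fin.ext_iff] at hmax
    simp at hmax
    ext; simp; omega
  obtain ⟨α, rfl⟩ := exists_appendMax_eq hA
  exact ⟨α, B, rfl⟩

/-! ### Avoiders and their decomposition at the maximum -/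

open Classical in
/-- The permutations of `n` letters avoiding `132` and `12…k`. -/
noncomputable def avoiders (k n : ℕ) : Finset (Equiv.Perm (Fin n)) :=
  univ.filter fun π => PermAvoids pattern132 π ∧ PermAvoids (increasingPattern k) π

theorem mem_avoiders {k n : ℕ} {π : Equiv.Perm (Fin n)} :
    π ∈ avoiders k n ↔ PermAvoids pattern132 π ∧ PermAvoids (increasingPattern k) π := by
  simp [avoiders]

/-- The empty pattern occurs in every permutation. -/
theorem avoiders_zero (n : ℕ) : avoiders 0 n = ∅ := by
  refine eq_empty_of_forall_notMem fun π hπ => (mem_avoiders.1 hπ).2 ?_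
  exact ⟨Fin.elim0, fun i => i.elim0, fun i => i.elim0⟩

theorem mem_avoiders_succ_zero (k : ℕ) (π : Equiv.Perm (Fin 0)) : π ∈ avoiders (k + 1) 0 :=
  mem_avoiders.2 ⟨fun ⟨f, _⟩ => (f 0).elim0, fun ⟨f, _⟩ => (f 0).elim0⟩

theorem inv_mem_avoiders {k n : ℕ} {π : Equiv.Perm (Fin n)} :
    π⁻¹ ∈ avoiders k n ↔ π ∈ avoiders k n := by
  have h132 : pattern132⁻¹ = pattern132 := Equiv.swap_inv _ _
  rw [mem_avoiders, mem_avoiders, permAvoids_inv h132,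
    permAvoids_inv (τ := increasingPattern k) inv_one]

theorem appendMax_mem_avoiders {k n : ℕ} {σ : Equiv.Perm (Fin n)} :
    appendMax σ ∈ avoiders (k + 1) (n + 1) ↔ σ ∈ avoiders k n := by
  rw [mem_avoiders, mem_avoiders, permAvoids_pattern132_appendMax]
  exact and_congr_right fun _ => not_congr (permContains_increasingPattern_appendMax σ)

theorem skewSum_mem_avoiders {k m l n : ℕ} (h : m + l = n) {A : Equiv.Perm (Fin m)}
    {B : Equiv.Perm (Fin l)} :
    skewSum h A B ∈ avoiders (k + 1) n ↔ A ∈ avoiders (k + 1) m ∧ B ∈ avoiders (k + 1) l := by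
  have hinc : PermAvoids (increasingPattern (k + 1)) (skewSum h A B) ↔
      PermAvoids (increasingPattern (k + 1)) A ∧ PermAvoids (increasingPattern (k + 1)) B :=
    (not_congr (permContains_increasingPattern_skewSum h A B)).trans not_or
  rw [mem_avoiders, mem_avoiders, mem_avoiders, permAvoids_pattern132_skewSum, hinc]
  exact and_and_and_comm

/-- The involutions of `n` letters avoiding `132` and `12…k`. -/
noncomputable def involutiveAvoiders (k n : ℕ) : Finset (Equiv.Perm (Fin n)) :=
  (avoiders k n).filter fun π => π⁻¹ = π

theorem mem_involutiveAvoiders {k n : ℕ} {π : Equiv.Perm (Fin n)} :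
    π ∈ involutiveAvoiders k n ↔ π ∈ avoiders k n ∧ π⁻¹ = π := by
  simp [involutiveAvoiders]

theorem skewSum_appendMax_apply {m l n : ℕ} (h : m + 1 + l = n + 1) (α : Equiv.Perm (Fin m))
    (B : Equiv.Perm (Fin l)) {j : Fin (n + 1)} (hj : j.val = m) :
    skewSum h (appendMax α) B j = Fin.last n := by
  have e : j = blockEquiv h (Sum.inl (Fin.last m)) := by ext; simp [hj]
  rw [e, skewSum_inl]
  ext
  simp
  omega

theorem filter_avoiders_eq_image {k m l n : ℕ} (h : m + 1 + l = n + 1) {j : Fin (n + 1)}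
    (hj : j.val = m) :
    (avoiders (k + 1) (n + 1)).filter (fun π => π j = Fin.last n) =
      (avoiders k m ×ˢ avoiders (k + 1) l).image fun p => skewSum h (appendMax p.1) p.2 := by
  ext π
  simp only [mem_filter, mem_image, mem_product, Prod.exists]
  constructor
  · rintro ⟨hπ, hmax⟩
    obtain ⟨α, B, rfl⟩ := exists_skewSum_eq_of_permAvoids h (mem_avoiders.1 hπ).1 hj hmax
    rw [skewSum_mem_avoiders, appendMax_mem_avoiders] at hπ
    exact ⟨α, B, hπ, rfl⟩
  · rintro ⟨α, B, hαB, rfl⟩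
    rw [skewSum_mem_avoiders, appendMax_mem_avoiders]
    exact ⟨hαB, skewSum_appendMax_apply h α B hj⟩

/-- The Catalan-type recurrence, summed over the position `j` of the maximum. -/
theorem card_avoiders_succ (k n : ℕ) :
    (avoiders (k + 1) (n + 1)).card =
      ∑ j ∈ range (n + 1), (avoiders k j).card * (avoiders (k + 1) (n - j)).card := by
  rw [card_eq_sum_card_fiberwise (f := fun π => π⁻¹ (Fin.last n)) (t := univ)
    (fun _ _ => mem_coe.2 (mem_univ _)), sum_range]
  refine sum_congr rfl fun j _ => ?_
  simp only [Equiv.Perm.inv_eq_iff_eq, eq_comm (a := Fin.last n)]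
  have h : j.val + 1 + (n - j.val) = n + 1 := by omega
  rw [filter_avoiders_eq_image h rfl, card_image_of_injOn, card_product]
  rintro ⟨α, B⟩ - ⟨α', B'⟩ - heq
  obtain ⟨h1, h2⟩ := skewSum_injective h heq
  exact Prod.ext (appendMax_injective h1) h2

theorem filter_involutiveAvoiders_last (k n : ℕ) :
    (involutiveAvoiders (k + 1) (n + 1)).filter (fun π => π (Fin.last n) = Fin.last n) =
      (involutiveAvoiders k n).image appendMax := by
  ext π
  simp only [mem_filter, mem_image, mem_involutiveAvoiders]
  constructor
  · rintro ⟨⟨hπ, hinv⟩, hmax⟩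
    obtain ⟨σ, rfl⟩ := exists_appendMax_eq hmax
    rw [appendMax_inv] at hinv
    exact ⟨σ, ⟨appendMax_mem_avoiders.1 hπ, appendMax_injective hinv⟩, rfl⟩
  · rintro ⟨σ, ⟨hσ, hinv⟩, rfl⟩
    exact ⟨⟨appendMax_mem_avoiders.2 hσ, by rw [appendMax_inv, hinv]⟩, appendMax_last σ⟩

/-- An involution exchanges the position and the value of the maximum; if they differ, the
position of the maximum lies in the first half. -/
theorem two_mul_le_of_involutive {k n : ℕ} {π : Equiv.Perm (Fin (n + 1))}
    (hπ : π ∈ involutiveAvoiders (k + 1) (n + 1)) {j : Fin (n + 1)} (hj : j ≠ Fin.last n)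
    (hmax : π j = Fin.last n) : 2 * (j.val + 1) ≤ n + 1 := by
  obtain ⟨hπ, hinv⟩ := mem_involutiveAvoiders.1 hπ
  have h : j.val + 1 + (n - j.val) = n + 1 := by omega
  have hlast : π (Fin.last n) = j := by
    rw [← hinv, Equiv.Perm.inv_eq_iff_eq, hmax]
  obtain ⟨α, B, rfl⟩ := exists_skewSum_eq_of_permAvoids h (mem_avoiders.1 hπ).1 rfl hmax
  have hjn : j.val < n := by
    have := Fin.val_lt_last hj
    exact this
  have e : Fin.last n = blockEquiv h (Sum.inr ⟨n - j.val - 1, by omega⟩) := by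
    ext; simp; omega
  rw [e, skewSum_inr, Fin.ext_iff, val_blockEquiv_inl] at hlast
  have := (B ⟨n - j.val - 1, by omega⟩).isLt
  omega

/-- An involution avoiding `132` whose maximum `n` is not fixed has the form `A ⊖ B ⊖ A⁻¹`,
where `A = α ⊕ 1` and `B` is an involution. -/
theorem filter_involutiveAvoiders_eq_image {k m l r n : ℕ} (h : m + 1 + r = n + 1)
    (h' : l + (m + 1) = r) {j : Fin (n + 1)} (hj : j.val = m) :
    (involutiveAvoiders (k + 1) (n + 1)).filter (fun π => π j = Fin.last n) =
      (avoiders k m ×ˢ involutiveAvoiders (k + 1) l).image fun p =>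
        skewSum h (appendMax p.1) (skewSum h' p.2 (appendMax p.1)⁻¹) := by
  ext π
  simp only [mem_filter, mem_image, mem_product, mem_involutiveAvoiders, Prod.exists]
  constructor
  · rintro ⟨⟨hπ, hinv⟩, hmax⟩
    obtain ⟨α, C, rfl⟩ := exists_skewSum_eq_of_permAvoids h (mem_avoiders.1 hπ).1 hj hmax
    -- Positions in the middle block cannot have values in the bottom block, since an involution
    -- sends the bottom values to the positions of the first block.
    obtain ⟨B, A', rfl⟩ := exists_skewSum_eq h' (π := C) fun i hi => by
      by_contra hlt
      have key : skewSum h (appendMax α) C (skewSum h (appendMax α) C (blockEquiv h (Sum.inr i)))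
          = blockEquiv h (Sum.inr i) :=
        (Equiv.Perm.inv_eq_iff_eq.1 (by rw [hinv])).symm
      have e : blockEquiv ((add_comm r (m + 1)).trans h) (Sum.inl (C i)) =
          blockEquiv h (Sum.inl ⟨(C i).val, by omega⟩) := by ext; simp
      rw [skewSum_inr, e, skewSum_inl, Fin.ext_iff] at key
      simp at key
      omega
    rw [skewSum_skewSum_inv] at hinv
    obtain ⟨h1, h2⟩ := skewSum_injective h hinv
    obtain ⟨h2, h3⟩ := skewSum_injective h' h2
    rw [skewSum_mem_avoiders, skewSum_mem_avoiders, appendMax_mem_avoiders] at hπ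
    exact ⟨α, B, ⟨hπ.1, hπ.2.1, h2⟩, by rw [h3]⟩
  · rintro ⟨α, B, ⟨hα, hB, hinv⟩, rfl⟩
    refine ⟨⟨?_, ?_⟩, skewSum_appendMax_apply h _ _ hj⟩
    · rw [skewSum_mem_avoiders, skewSum_mem_avoiders, inv_mem_avoiders, appendMax_mem_avoiders]
      exact ⟨hα, hB, hα⟩
    · rw [skewSum_skewSum_inv, inv_inv, hinv]

/-- The involutions avoiding `132` and `12…k`, weighted by `ε` to the number of inversions. -/
noncomputable def weightedCount (ε : ℂ) (k n : ℕ) : ℂ :=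
  ∑ π ∈ involutiveAvoiders k n, ε ^ inversionCount π

/-- For a sign `ε`, the mutually inverse outer blocks of `A ⊖ B ⊖ A⁻¹` contribute only `ε ^ m`,
coming from the `m * (l + m)` inversions between `A` and the other blocks and the `l * m`
inversions between `B` and `A⁻¹`. -/
theorem pow_inversionCount_skewSum {ε : ℂ} (hε : ε * ε = 1) {m l r n : ℕ} (h : m + r = n)
    (h' : l + m = r) (A : Equiv.Perm (Fin m)) (B : Equiv.Perm (Fin l)) :
    ε ^ inversionCount (skewSum h A (skewSum h' B A⁻¹)) = ε ^ m * ε ^ inversionCount B := by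
  have hodd : ∀ a : ℕ, (ε ^ a) * ε ^ a = 1 := fun a => by rw [← mul_pow, hε, one_pow]
  have hsq : ε ^ (m * m) = ε ^ m := by
    obtain ⟨t, ht⟩ := Nat.even_mul_succ_self m
    have h1 : ε ^ (m * m) * ε ^ m = 1 := by
      rw [← pow_add, show m * m + m = t + t by rw [← ht]; ring, pow_add,
        hodd]
    calc ε ^ (m * m) = ε ^ (m * m) * ε ^ m * ε ^ m := by rw [mul_assoc, hodd, mul_one]
      _ = ε ^ m := by rw [h1, one_mul]
  rw [inversionCount_skewSum, inversionCount_skewSum, inversionCount_inv, ← h', mul_add,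
    mul_comm l m]
  simp only [pow_add, hsq]
  linear_combination (ε ^ inversionCount B * ε ^ m * ε ^ (m * l) * ε ^ (m * l)) *
    hodd (inversionCount A) + ε ^ inversionCount B * ε ^ m * hodd (m * l)

/-- The first term counts the involutions fixing the maximum, and the `j`-th summand those with
the maximum at position `j`. -/
theorem weightedCount_succ {ε : ℂ} (hε : ε * ε = 1) (k n : ℕ) :
    weightedCount ε (k + 1) (n + 1) = weightedCount ε k n +
      ∑ j ∈ range (n + 1), if 2 * (j + 1) ≤ n + 1 then
        ε ^ (j + 1) * (avoiders k j).card * weightedCount ε (k + 1) (n + 1 - 2 * (j + 1))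
      else 0 := by
  rw [weightedCount, ← sum_fiberwise (s := involutiveAvoiders (k + 1) (n + 1))
    (g := fun π => π⁻¹ (Fin.last n)), Fin.sum_univ_castSucc, add_comm, sum_range_succ,
    if_neg (by omega), add_zero, sum_range]
  simp only [Equiv.Perm.inv_eq_iff_eq, eq_comm (a := Fin.last n)]
  congr 1
  · rw [filter_involutiveAvoiders_last, sum_image appendMax_injective.injOn, weightedCount]
    simp only [inversionCount_appendMax]
  · refine sum_congr rfl fun j _ => ?_
    split_ifs with hj
    · have h : j.val + 1 + (n - j.val) = n + 1 := by omega
      have h' : n + 1 - 2 * (j.val + 1) + (j.val + 1) = n - j.val := by omega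
      rw [filter_involutiveAvoiders_eq_image h h' (by simp), sum_image]
      · simp only [pow_inversionCount_skewSum hε, sum_product, weightedCount, ← mul_sum,
          sum_const, nsmul_eq_mul]
        ring
      · rintro ⟨α, B⟩ - ⟨α', B'⟩ - heq
        obtain ⟨h1, h2⟩ := skewSum_injective h heq
        exact Prod.ext (appendMax_injective h1) (skewSum_injective h' h2).1
    · rw [filter_eq_empty_iff.2, sum_empty]
      intro π hπ hmax
      exact hj (two_mul_le_of_involutive hπ (Fin.castSucc_lt_last j).ne hmax)

/-! ### Generating functions -/

/-- The generating function of all permutations avoiding `132` and `12…k`. -/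
noncomputable def avoiderGF (k : ℕ) : PowerSeries ℂ :=
  PowerSeries.mk fun n => ((avoiders k n).card : ℂ)

/-- The generating function of the involutions avoiding `132` and `12…k`, weighted by `ε` to the
number of inversions. -/
noncomputable def weightedGF (ε : ℂ) (k : ℕ) : PowerSeries ℂ :=
  PowerSeries.mk (weightedCount ε k)

/-- The series `C_k(ε x²)`, where `C_k` is the generating function of the permutations avoiding
`132` and `12…k`. -/
noncomputable def dilatedGF (ε : ℂ) (k : ℕ) : PowerSeries ℂ :=
  PowerSeries.expand 2 two_ne_zero (PowerSeries.rescale ε (avoiderGF k))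

theorem avoiderGF_zero : avoiderGF 0 = 0 := by
  ext n
  simp [avoiderGF, avoiders_zero]

theorem avoiderGF_succ (k : ℕ) :
    avoiderGF (k + 1) = 1 + PowerSeries.X * (avoiderGF k * avoiderGF (k + 1)) := by
  ext n
  rcases n with _ | n
  · have h : avoiders (k + 1) 0 = univ := eq_univ_of_forall (mem_avoiders_succ_zero k)
    simp [avoiderGF, h]
  · rw [map_add, PowerSeries.coeff_succ_X_mul, PowerSeries.coeff_mul,
      Nat.sum_antidiagonal_eq_sum_range_succ_mk]
    simp [avoiderGF, card_avoiders_succ, PowerSeries.coeff_one]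

theorem dilatedGF_zero (ε : ℂ) : dilatedGF ε 0 = 0 := by
  simp [dilatedGF, avoiderGF_zero]

theorem rescale_X_eq (ε : ℂ) :
    PowerSeries.rescale ε PowerSeries.X = PowerSeries.C ε * PowerSeries.X := by
  ext n
  rcases n with _ | _ | n <;> simp [PowerSeries.coeff_X]

theorem expand_rescale_X_mul (ε : ℂ) (f : PowerSeries ℂ) :
    PowerSeries.expand 2 two_ne_zero (PowerSeries.rescale ε (PowerSeries.X * f)) =
      PowerSeries.C ε * PowerSeries.X ^ 2 *
        PowerSeries.expand 2 two_ne_zero (PowerSeries.rescale ε f) := by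
  rw [map_mul, map_mul, rescale_X_eq, map_mul, PowerSeries.expand_C, PowerSeries.expand_X]

theorem dilatedGF_succ (ε : ℂ) (k : ℕ) :
    dilatedGF ε (k + 1) =
      1 + PowerSeries.C ε * PowerSeries.X ^ 2 * (dilatedGF ε k * dilatedGF ε (k + 1)) := by
  conv_lhs => rw [dilatedGF, avoiderGF_succ, map_add, map_one, map_add, map_one,
    expand_rescale_X_mul, map_mul, map_mul]
  rfl

/-- Coefficients of `F(x²) G(x)`. -/
theorem coeff_expand_two_mul (F G : PowerSeries ℂ) (N : ℕ) :
    PowerSeries.coeff N (PowerSeries.expand 2 two_ne_zero F * G) =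
      ∑ m ∈ range (N + 1), if 2 * m ≤ N then
        PowerSeries.coeff m F * PowerSeries.coeff (N - 2 * m) G else 0 := by
  rw [PowerSeries.coeff_mul, Nat.sum_antidiagonal_eq_sum_range_succ_mk, ← sum_filter]
  symm
  refine sum_of_injOn (fun m => 2 * m) (fun a _ b _ h => by simpa using h) ?_ ?_ ?_
  · intro m hm
    simp at hm ⊢
    omega
  · intro p hp hnot
    rw [PowerSeries.coeff_expand_of_not_dvd, zero_mul]
    rintro ⟨m, rfl⟩
    simp at hp hnot
    omega
  · intro m _
    rw [PowerSeries.coeff_expand_mul]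

theorem weightedGF_zero (ε : ℂ) : weightedGF ε 0 = 0 := by
  ext n
  simp [weightedGF, weightedCount, involutiveAvoiders, avoiders_zero]

theorem weightedCount_succ_zero (ε : ℂ) (k : ℕ) : weightedCount ε (k + 1) 0 = 1 := by
  have h : involutiveAvoiders (k + 1) 0 = {1} := by
    ext π
    simp [mem_involutiveAvoiders, mem_avoiders_succ_zero, Subsingleton.elim π 1]
  simp [weightedCount, h, inversionCount]

theorem weightedGF_succ {ε : ℂ} (hε : ε * ε = 1) (k : ℕ) :
    weightedGF ε (k + 1) = 1 + PowerSeries.X * weightedGF ε k +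
      PowerSeries.C ε * PowerSeries.X ^ 2 * dilatedGF ε k * weightedGF ε (k + 1) := by
  rw [dilatedGF, ← expand_rescale_X_mul]
  ext n
  rw [map_add, map_add, coeff_expand_two_mul]
  rcases n with _ | n
  · simp [weightedGF, weightedCount_succ_zero]
  · have hc : ∀ j, PowerSeries.coeff j (avoiderGF k) = (avoiders k j).card := fun j => by
      simp [avoiderGF]
    have h0 : PowerSeries.constantCoeff (PowerSeries.X * avoiderGF k) = 0 := by simp
    rw [sum_range_succ']
    simp [-map_mul, hc, h0, weightedGF, weightedCount_succ hε, PowerSeries.coeff_one,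
      PowerSeries.coeff_succ_X_mul]

theorem involutionGF_eq_weightedGF (k : ℕ) :
    involutionGF (increasingPattern k) = weightedGF 1 k := by
  ext n
  have h : avoidingInvolutions (increasingPattern k) n = ↑(involutiveAvoiders k n) := by
    ext π
    simp [avoidingInvolutions, mem_involutiveAvoiders, mem_avoiders, and_comm]
  simp [involutionGF, weightedGF, weightedCount, h]

/-- Averaging the weights `1` and `(-1) ^ inv` selects the even involutions. -/
theorem two_mul_evenInvolutionGF (k : ℕ) :
    2 * evenInvolutionGF (increasingPattern k) = weightedGF 1 k + weightedGF (-1) k := by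
  classical
  ext n
  have h : avoidingEvenInvolutions (increasingPattern k) n =
      ↑((involutiveAvoiders k n).filter fun π => Even (inversionCount π)) := by
    ext π
    simp [avoidingEvenInvolutions, avoidingInvolutions, mem_involutiveAvoiders, mem_avoiders,
      and_comm]
  rw [two_mul, map_add, map_add, ← two_mul]
  simp only [evenInvolutionGF, weightedGF, weightedCount, PowerSeries.coeff_mk, h,
    Set.ncard_coe_finset, card_filter, Nat.cast_sum, mul_sum, ← sum_add_distrib, one_pow]
  refine sum_congr rfl fun π _ => ?_
  rcases Nat.even_or_odd (inversionCount π) with hπ | hπ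
  · simp [hπ, hπ.neg_one_pow, one_add_one_eq_two]
  · simp [Nat.not_even_iff_odd.2 hπ, hπ.neg_one_pow]

/-! ### Chebyshev quotients -/

theorem chebU_add_one {K : Type*} [Field K] (k : ℤ) (t : K) :
    chebU (k + 1) t = 2 * t * chebU k t - chebU (k - 1) t := by
  simp [chebU, Polynomial.Chebyshev.U_add_one]

theorem two_ne_zero_laurentSeries : (2 : LaurentSeries ℂ) ≠ 0 := by
  rw [← map_ofNat (HahnSeries.C : ℂ →+* LaurentSeries ℂ) 2]
  exact (map_ne_zero _).2 two_ne_zero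

/-- For a square root `t` of `ε x²`, the Chebyshev quotient `R_k(ε x²)` is the series
`C_k(ε x²)`: both satisfy `R_{k+1} (1 - t² R_k) = 1`, and this equation also yields
`U_{k+1}(1 / 2t) ≠ 0`. -/
theorem chebU_ne_zero_and_chebR_eq {ε : ℂ} {t : LaurentSeries ℂ} (ht : t ≠ 0)
    (hts : t * t = ((PowerSeries.C ε * PowerSeries.X ^ 2 : PowerSeries ℂ) : LaurentSeries ℂ))
    (k : ℕ) :
    chebU k (1 / (2 * t)) ≠ 0 ∧
      chebR k (t * t) = ((dilatedGF ε k : PowerSeries ℂ) : LaurentSeries ℂ) := by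
  induction k with
  | zero => simp [chebR_mul_self, chebU, dilatedGF_zero]
  | succ k ih =>
    obtain ⟨hU, hR⟩ := ih
    rw [chebR_mul_self, div_eq_iff (mul_ne_zero ht hU)] at hR
    have hrec := congrArg (fun f : PowerSeries ℂ => (f : LaurentSeries ℂ)) (dilatedGF_succ ε k)
    simp only [PowerSeries.coe_add, PowerSeries.coe_mul _ (dilatedGF ε k * _), ← hts,
      PowerSeries.coe_one, PowerSeries.coe_mul (dilatedGF ε k)] at hrec
    have hstep : t * chebU ((k + 1 : ℕ) : ℤ) (1 / (2 * t)) =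
        chebU k (1 / (2 * t)) - t * chebU ((k : ℤ) - 1) (1 / (2 * t)) := by
      rw [Nat.cast_succ, chebU_add_one]
      have := two_ne_zero_laurentSeries
      field_simp
    have key : chebU k (1 / (2 * t)) = ((dilatedGF ε (k + 1) : PowerSeries ℂ) : LaurentSeries ℂ) *
        (t * chebU ((k + 1 : ℕ) : ℤ) (1 / (2 * t))) := by
      rw [hstep, hR]
      linear_combination (-chebU k (1 / (2 * t))) * hrec
    have hne : chebU ((k + 1 : ℕ) : ℤ) (1 / (2 * t)) ≠ 0 := fun h0 => hU (by rw [key, h0]; simp)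
    refine ⟨hne, ?_⟩
    rw [chebR_mul_self, div_eq_iff (mul_ne_zero ht hne), ← key]
    simp

theorem formalX_ne_zero : formalX ≠ 0 := by
  rw [formalX, Ne, ← PowerSeries.coe_zero, HahnSeries.ofPowerSeries_injective.eq_iff]
  exact PowerSeries.X_ne_zero

theorem chebR_formalX_sq (k : ℕ) :
    chebR k (formalX ^ 2) = ((dilatedGF 1 k : PowerSeries ℂ) : LaurentSeries ℂ) := by
  rw [pow_two]
  exact (chebU_ne_zero_and_chebR_eq formalX_ne_zero (by simp [formalX, pow_two]) k).2

theorem chebU_formalX_ne_zero (k : ℕ) : chebU k (1 / (2 * formalX)) ≠ 0 :=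
  (chebU_ne_zero_and_chebR_eq (ε := 1) formalX_ne_zero (by simp [formalX, pow_two]) k).1

theorem chebR_neg_formalX_sq (k : ℕ) :
    chebR k (-formalX ^ 2) = ((dilatedGF (-1) k : PowerSeries ℂ) : LaurentSeries ℂ) := by
  -- The square root of `-x²` in use is `i x`.
  set c : LaurentSeries ℂ := ((PowerSeries.C Complex.I : PowerSeries ℂ) : LaurentSeries ℂ) with hc
  have hcc : c * c = -1 := by
    rw [hc, ← PowerSeries.coe_mul, ← map_mul, Complex.I_mul_I]
    simp
  have hc0 : c ≠ 0 := fun h => by simp [h] at hcc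
  have e : -formalX ^ 2 = (c * formalX) * (c * formalX) := by
    linear_combination (-formalX ^ 2) * hcc
  rw [e]
  refine (chebU_ne_zero_and_chebR_eq (mul_ne_zero hc0 formalX_ne_zero) ?_ k).2
  rw [← e]
  simp [formalX, pow_two]

/-- Solving the recurrence for `I_{k+1}`, with `R_{k+1}(ε x²)` as the inverse of
`1 - ε x² R_k(ε x²)`. -/
theorem weightedGF_succ_eq_mul {ε : ℂ} (hε : ε * ε = 1) (k : ℕ) :
    weightedGF ε (k + 1) =
      (1 + PowerSeries.X * weightedGF ε k) * dilatedGF ε (k + 1) := by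
  linear_combination dilatedGF ε (k + 1) * weightedGF_succ hε k -
    weightedGF ε (k + 1) * dilatedGF_succ ε k

theorem involutionGF_mul_chebU (k : ℕ) :
    ((involutionGF (increasingPattern k) : PowerSeries ℂ) : LaurentSeries ℂ) *
        (formalX * chebU k (1 / (2 * formalX))) =
      ∑ j ∈ range k, chebU j (1 / (2 * formalX)) := by
  induction k with
  | zero => simp [involutionGF_eq_weightedGF, weightedGF_zero]
  | succ k ih =>
    have hR := chebR_formalX_sq (k + 1)
    rw [pow_two, chebR_mul_self,
      div_eq_iff (mul_ne_zero formalX_ne_zero (chebU_formalX_ne_zero (k + 1)))] at hR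
    have hk : ((k + 1 : ℕ) : ℤ) - 1 = k := by simp
    rw [hk] at hR
    rw [sum_range_succ, ← ih, involutionGF_eq_weightedGF, involutionGF_eq_weightedGF,
      weightedGF_succ_eq_mul (mul_one 1)]
    simp only [PowerSeries.coe_mul, PowerSeries.coe_add, PowerSeries.coe_one]
    rw [mul_assoc, ← hR, formalX]
    ring

/-! ### The even involutions -/

/-- The recurrence obtained by adding those for the weights `ε = 1` and `ε = -1` and eliminating
the signed series. -/
theorem two_mul_evenInvolutionGF_succ (k : ℕ) :
    2 * evenInvolutionGF (increasingPattern (k + 1)) =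
      (2 + PowerSeries.X ^ 2 * (dilatedGF 1 k + dilatedGF (-1) k) *
          involutionGF (increasingPattern (k + 1)) +
        PowerSeries.X * (2 * evenInvolutionGF (increasingPattern k))) * dilatedGF (-1) (k + 1) := by
  have h1 := weightedGF_succ (mul_one (1 : ℂ)) k
  have h2 := weightedGF_succ (show (-1 : ℂ) * -1 = 1 by norm_num) k
  have h3 := dilatedGF_succ (-1) k
  have h4 := two_mul_evenInvolutionGF (k + 1)
  rw [map_neg, map_one] at h2 h3
  rw [map_one] at h1
  rw [involutionGF_eq_weightedGF, two_mul_evenInvolutionGF k]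
  linear_combination h4 + dilatedGF (-1) (k + 1) * (h1 + h2) -
    (weightedGF 1 (k + 1) + weightedGF (-1) (k + 1)) * h3

theorem evenInvolutionGF_laurent_succ (k : ℕ) :
    ((evenInvolutionGF (increasingPattern (k + 1)) : PowerSeries ℂ) : LaurentSeries ℂ) =
      (1 + formalX ^ 2 * chebRe k (formalX ^ 2) *
          ((involutionGF (increasingPattern (k + 1)) : PowerSeries ℂ) : LaurentSeries ℂ) +
        formalX * ((evenInvolutionGF (increasingPattern k) : PowerSeries ℂ) : LaurentSeries ℂ)) *
      chebR (k + 1) (-formalX ^ 2) := by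
  have h := congrArg (HahnSeries.ofPowerSeries ℤ ℂ) (two_mul_evenInvolutionGF_succ k)
  have h2 := two_ne_zero_laurentSeries
  simp only [map_mul, map_add, map_pow, map_ofNat] at h
  rw [chebRe, chebR_neg_formalX_sq, chebR_neg_formalX_sq, chebR_formalX_sq]
  refine mul_left_cancel₀ h2 ?_
  field_simp
  rw [formalX]
  linear_combination h

theorem evenInvolutionGF_eq_sum (k : ℕ) :
    ((evenInvolutionGF (increasingPattern k) : PowerSeries ℂ) : LaurentSeries ℂ) =
      ∑ j ∈ range k,
        formalX ^ j *
          (1 + formalX ^ 2 * chebRe (k - 1 - j) (formalX ^ 2) *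
            ((involutionGF (increasingPattern (k - j)) : PowerSeries ℂ) : LaurentSeries ℂ)) *
          ∏ i ∈ Icc (k - j) k, chebR i (-formalX ^ 2) := by
  induction k with
  | zero =>
    have h := congrArg (HahnSeries.ofPowerSeries ℤ ℂ) (two_mul_evenInvolutionGF 0)
    refine mul_left_cancel₀ two_ne_zero_laurentSeries ?_
    rw [map_mul, map_ofNat] at h
    rw [h]
    simp [weightedGF_zero]
  | succ k ih =>
    rw [evenInvolutionGF_laurent_succ, ih, sum_range_succ', add_mul, mul_sum, sum_mul, add_comm]
    congr 1
    · refine sum_congr rfl fun j _ => ?_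
      rw [show k + 1 - (j + 1) = k - j by omega, show k + 1 - 1 - (j + 1) = k - 1 - j by omega,
        prod_Icc_succ_top (by omega : k - j ≤ k + 1)]
      ring
    · simp

theorem mainTheorem6 (k : ℕ) (hk : 1 ≤ k) :
    ((evenInvolutionGF (increasingPattern k) : PowerSeries ℂ) : LaurentSeries ℂ) =
        ∑ j ∈ Finset.range k,
          formalX ^ j *
            (1 + formalX ^ 2 * chebRe (k - 1 - j) (formalX ^ 2) *
              ((involutionGF (increasingPattern (k - j)) : PowerSeries ℂ) : LaurentSeries ℂ)) *
            ∏ i ∈ Finset.Icc (k - j) k, chebR i (-formalX ^ 2) ∧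
      ((involutionGF (increasingPattern k) : PowerSeries ℂ) : LaurentSeries ℂ) =
        1 / (formalX * chebU k (1 / (2 * formalX))) *
          ∑ j ∈ Finset.range k, chebU j (1 / (2 * formalX)) := by
  refine ⟨evenInvolutionGF_eq_sum k, ?_⟩
  rw [← involutionGF_mul_chebU k]
  rw [one_div, inv_mul_eq_div,
    mul_div_cancel_right₀ _ (mul_ne_zero formalX_ne_zero (chebU_formalX_ne_zero k))]
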